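/- All graphs are finite and simple. For a graph $H$, let $\alpha(H)$ be its independence number, let $\mathrm{Supp}(H)$ be the set of vertices $w$ of $H$ such that $x_w\neq 0$ for some real vector $x$ in the null space of the adjacency matrix of $H$, and let $N[\mathrm{Supp}(H)]$ be the set $\mathrm{Supp}(H)$ together with all neighbours of its vertices. For a tree $T$, the $S$-forest $\mathcal{F}_S(T)$ is the subgraph of $T$ induced by $N[\mathrm{Supp}(T)]$, and the $N$-forest $\mathcal{F}_N(T)$ is the graph obtained from $T$ by deleting the vertices of $\mathcal{F}_S(T)$. Let $G$ be a unicyclic graph, that is, a connected graph with exactly one cycle $C$. For a vertex $v$ of $C$, the pendant tree $G\{v\}$ is the largest connected induced subgraph of $G$ that contains $v$ and no other vertex of $C$, and $G-G\{v\}$ is the graph (again a tree) obtained from $G$ by deleting the vertices of $G\{v\}$. The graph $G$ is of Type I if there is a vertex $u$ of $C$ that is saturated by every maximum matching of $G\{u\}$. Theorem. Let $G$ be a unicyclic graph of Type I with cycle $C$, and let $v$ be a vertex of $C$ such that $v\notin \mathrm{Supp}(G\{v\})$. Then $$\alpha(G)=|\mathrm{Supp}(G\{v\})|+|\mathrm{Supp}(G-G\{v\})|+\frac{|V(\mathcal{F}_N(G\{v\}))|+|V(\mathcal{F}_N(G-G\{v\}))|}{2}.$$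 -/

import Mathlib

namespace NullDecomp

/-- The subgraph `C` of `G` is a cycle of `G`. -/
def IsCycleSubgraph {V : Type*} {G : SimpleGraph V} (C : G.Subgraph) : Prop :=
  ∃ (u : V) (p : G.Walk u u), p.IsCycle ∧ p.toSubgraph = C

/-- A unicyclic graph: connected, with exactly one cycle. -/
def IsUnicyclic {V : Type*} (G : SimpleGraph V) : Prop :=
  G.Connected ∧ ∃! C : G.Subgraph, IsCycleSubgraph C

/-- The vertex sets containing `v` and no other vertex of `C` that induce a connected subgraph. -/
def pendantFamily {V : Type*} (G : SimpleGraph V) (C : G.Subgraph) (v : V) : Set (Set V) :=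
  {S | v ∈ S ∧ (∀ w ∈ S, w ∈ C.verts → w = v) ∧ (G.induce S).Connected}

/-- The vertex set of the pendant tree of `G` at `v` (for `v` on the cycle `C`): the largest
vertex set in `pendantFamily G C v`, see `isGreatest_pendantVerts`. -/
def pendantVerts {V : Type*} (G : SimpleGraph V) (C : G.Subgraph) (v : V) : Set V :=
  ⋃₀ pendantFamily G C v

theorem mem_pendantVerts_self {V : Type*} (G : SimpleGraph V) (C : G.Subgraph) (v : V) :
    v ∈ pendantVerts G C v := by
  refine ⟨{v}, ⟨rfl, fun w hw _ => hw, ?_⟩, rfl⟩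
  have : Nonempty ({v} : Set V) := ⟨⟨v, rfl⟩⟩
  refine ⟨fun a b => ?_⟩
  rw [Subsingleton.elim a b]

theorem isGreatest_pendantVerts {V : Type*} (G : SimpleGraph V) (C : G.Subgraph) (v : V) :
    IsGreatest (pendantFamily G C v) (pendantVerts G C v) := by
  refine ⟨⟨mem_pendantVerts_self G C v, ?_, ?_⟩, fun S hS => Set.subset_sUnion_of_mem hS⟩
  · rintro w ⟨S, hS, hw⟩ hwC
    exact hS.2.1 w hw hwC
  · refine SimpleGraph.induce_sUnion_connected_of_pairwise_not_disjoint ?_ ?_ ?_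
    · obtain ⟨S, hS, -⟩ := mem_pendantVerts_self G C v
      exact ⟨S, hS⟩
    · intro S T hS hT
      exact ⟨v, hS.1, hT.1⟩
    · intro S hS
      exact hS.2.2

/-- The pendant tree of `G` at `v`. -/
abbrev pendantTree {V : Type*} (G : SimpleGraph V) (C : G.Subgraph) (v : V) :
    SimpleGraph (pendantVerts G C v) :=
  G.induce (pendantVerts G C v)

/-- The vertex `v`, as a vertex of the pendant tree of `G` at `v`. -/
def pendantRoot {V : Type*} (G : SimpleGraph V) (C : G.Subgraph) (v : V) :
    pendantVerts G C v :=
  ⟨v, mem_pendantVerts_self G C v⟩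

/-- The graph obtained from `G` by deleting the vertices of the pendant tree at `v`. -/
abbrev pendantCompl {V : Type*} (G : SimpleGraph V) (C : G.Subgraph) (v : V) :
    SimpleGraph ((pendantVerts G C v)ᶜ : Set V) :=
  G.induce (pendantVerts G C v)ᶜ

/-- A matching with the largest possible number of edges. -/
def IsMaximumMatching {W : Type*} {T : SimpleGraph W} (M : T.Subgraph) : Prop :=
  M.IsMatching ∧ ∀ M' : T.Subgraph, M'.IsMatching → M'.edgeSet.ncard ≤ M.edgeSet.ncard

/-- `v` is matched in `T`: it is saturated by every maximum matching. (In a one-vertex graph the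
only matching is empty, so that the vertex is mismatched.) -/
def IsMatched {W : Type*} (T : SimpleGraph W) (v : W) : Prop :=
  ∀ M : T.Subgraph, IsMaximumMatching M → v ∈ M.verts

/-- Unicyclic graphs of Type I. -/
def IsTypeI {V : Type*} (G : SimpleGraph V) : Prop :=
  IsUnicyclic G ∧ ∃ C : G.Subgraph, IsCycleSubgraph C ∧
    ∃ v ∈ C.verts, IsMatched (pendantTree G C v) (pendantRoot G C v)

open Classical in
/-- The null space of the real adjacency matrix of `T`. -/
noncomputable def nullSpace {W : Type*} [Finite W] (T : SimpleGraph W) : Submodule ℝ (W → ℝ) :=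
  letI := Fintype.ofFinite W
  LinearMap.ker (T.adjMatrix ℝ).mulVecLin

/-- The support of `T`: vertices at which some vector of the null space is nonzero. -/
def supp {W : Type*} [Finite W] (T : SimpleGraph W) : Set W :=
  {w | ∃ x ∈ nullSpace T, x w ≠ 0}

/-- The S-forest: the subgraph induced by the closed neighbourhood of the support. -/
def sForest {W : Type*} [Finite W] (T : SimpleGraph W) : T.Subgraph :=
  (⊤ : T.Subgraph).induce (supp T ∪ {w | ∃ s ∈ supp T, T.Adj s w})

/-- The N-forest: what remains of `T` after deleting the vertices of the S-forest. -/
def nForest {W : Type*} [Finite W] (T : SimpleGraph W) : T.Subgraph :=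
  (⊤ : T.Subgraph).deleteVerts (sForest T).verts

end NullDecomp

/-! Deleting the pendant tree at `v` splits the graph into two acyclic pieces. For every finite
forest, twice the independence number is twice the size of the support plus the order of the
N-forest (`indepNum_of_isAcyclic`). This follows by removing a leaf `l` with its neighbour `p`: the
independence number drops by one, while support and N-forest are unchanged on the other vertices and
lose total weight two on `{l, p}`.

The same induction shows that a vertex outside the support is avoided by some maximum independent
set. Every edge between the two pieces ends at `v` on the tree side, so such a set of the pendant
tree can be united with any maximum independent set of the rest, and the two independence numbers
add up (`indepNum_eq_add`). -/

namespace NullDecomp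

open SimpleGraph

/-! ### Leaves, bridges and null vectors of forests -/

section Forest

variable {W : Type*} (T : SimpleGraph W)

open Classical in
theorem mem_nullSpace_iff [Fintype W] (x : W → ℝ) :
    x ∈ nullSpace T ↔ ∀ u, ∑ w, (if T.Adj u w then x w else 0) = 0 := by
  simp only [nullSpace, LinearMap.mem_ker, Matrix.mulVecLin_apply, funext_iff,
    Matrix.mulVec, dotProduct, adjMatrix_apply, ite_mul, one_mul, zero_mul, Pi.zero_apply]
  convert Iff.rfl

theorem mem_nForest_verts_iff [Finite W] (w : W) :
    w ∈ (nForest T).verts ↔ w ∉ supp T ∧ ∀ s ∈ supp T, ¬ T.Adj s w := by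
  simp [nForest, sForest]

variable {T}

/-- A finite acyclic graph with an edge has a vertex of degree one other than any given vertex. -/
theorem exists_leaf_ne [Finite W] (hT : T.IsAcyclic) {a b : W} (hab : T.Adj a b) (v : W) :
    ∃ l p, l ≠ v ∧ ∀ w, T.Adj l w ↔ w = p := by
  have : Nonempty W := ⟨v⟩
  -- Both ends of a longest path are leaves, and at most one of them is `v`.
  obtain ⟨x, y, q, hq, hmax⟩ := Walk.exists_isPath_forall_isPath_length_le_length T
  have hnil : ¬ q.Nil := by
    have h1 := hmax a b hab.toWalk (by simp [hab.ne])
    intro h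
    rw [← Walk.length_eq_zero_iff] at h
    simp [h] at h1
  have hne : x ≠ y := hq.nil_iff_eq.not.mp hnil
  have hx : ∀ w, T.Adj x w ↔ w = q.snd := by
    refine fun w => ⟨fun hadj => ?_, fun h => h ▸ q.adj_snd hnil⟩
    apply hT.eq_snd_of_adj_start hq hadj
    have : ¬(q.cons hadj.symm).IsPath := by grind [Walk.length_cons]
    grind [hq.cons]
  have hy : ∀ w, T.Adj y w ↔ w = q.penultimate := by
    refine fun w => ⟨fun hadj => ?_, fun h => h ▸ (q.adj_penultimate hnil).symm⟩
    apply hT.eq_penultimate_of_adj_end hq hadj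
    have : ¬(q.concat hadj).IsPath := by grind [Walk.length_concat]
    grind [hq.concat]
  by_cases h : x = v
  · exact ⟨y, _, fun h' => hne (h.trans h'.symm), hy⟩
  · exact ⟨x, _, h, hx⟩

/-- Vertices joined by a walk in an induced subgraph are joined by a walk inside its vertex set. -/
theorem exists_walk_support_subset {S : Set W} {a b : S} (h : (T.induce S).Reachable a b) :
    ∃ q : T.Walk a b, ∀ c ∈ q.support, c ∈ S := by
  obtain ⟨q⟩ := h
  refine ⟨q.map (Embedding.induce S).toHom, fun c hc => ?_⟩
  have hc' : c ∈ (q.map (Embedding.induce (G := T) S).toHom).support := hc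
  rw [Walk.support_map, List.mem_map] at hc'
  obtain ⟨d, -, rfl⟩ := hc'
  exact d.2

/-- Two distinct neighbours of a vertex of an acyclic graph are separated by deleting it. -/
theorem not_reachable_of_adj_of_adj (hT : T.IsAcyclic) {S : Set W} {p : W} (hp : p ∉ S)
    {a b : S} (ha : T.Adj p a) (hb : T.Adj p b) (hab : a ≠ b) :
    ¬ (T.induce S).Reachable b a := by
  intro hreach
  obtain ⟨q, hq⟩ := exists_walk_support_subset hreach
  -- The edge `pa` is a bridge, so the walk from `p` through `b` to `a` must use it; but its part
  -- inside `S` misses `p`.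
  have hmem := isBridge_iff_forall_walk_mem_edges.mp
    (isAcyclic_iff_forall_adj_isBridge.mp hT ha) (Walk.cons hb q)
  rw [Walk.edges_cons, List.mem_cons] at hmem
  rcases hmem with h | h
  · rw [Sym2.congr_right] at h
    exact hab (Subtype.ext h)
  · exact hp (hq p (Walk.fst_mem_support_of_mem_edges _ h))

/-- A vector of the null space can be cut off to a connected component. -/
theorem exists_mem_nullSpace_eq_zero_of_not_reachable [Finite W] {w : W} (hw : w ∈ supp T) :
    ∃ x ∈ nullSpace T, x w ≠ 0 ∧ ∀ u, ¬ T.Reachable w u → x u = 0 := by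
  classical
  have := Fintype.ofFinite W
  obtain ⟨x, hx, hxw⟩ := hw
  refine ⟨fun u => if T.Reachable w u then x u else 0, ?_, by simpa using hxw,
    fun u hu => by simp [hu]⟩
  rw [mem_nullSpace_iff] at hx ⊢
  intro u
  by_cases hu : T.Reachable w u
  · refine (Finset.sum_congr rfl fun c _ => ?_).trans (hx u)
    by_cases h : T.Adj u c
    · simp [h, hu.trans h.reachable]
    · simp [h]
  · refine Finset.sum_eq_zero fun c _ => ?_
    by_cases h : T.Adj u c
    · have : ¬ T.Reachable w c := fun h' => hu (h'.trans h.symm.reachable)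
      simp [this]
    · simp [h]

end Forest

/-! ### Support and N-forest under removal of a leaf and its neighbour -/

section Leaf

variable {W : Type*} {T : SimpleGraph W} {l p : W}

theorem sum_eq_add_add_sum_compl_pair [Fintype W] [DecidableEq W] (hlp : l ≠ p) (f : W → ℝ) :
    ∑ w, f w = f l + f p + ∑ w : ({l, p}ᶜ : Set W), f w := by
  classical
  have h := Finset.sum_compl_add_sum ({l, p} : Finset W) f
  rw [Finset.sum_pair hlp] at h
  rw [← h, add_comm]
  congr 1
  refine (Finset.sum_subtype _ (fun x => ?_) f)
  simp

/-- The equation at `l` reads `x p = 0`, and no remaining vertex is adjacent to `l`, so the other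
equations lose only zero terms. -/
theorem eq_zero_and_comp_val_mem_nullSpace [Finite W] (hl : ∀ w, T.Adj l w ↔ w = p) {x : W → ℝ}
    (hx : x ∈ nullSpace T) :
    x p = 0 ∧ (fun w : ({l, p}ᶜ : Set W) => x w) ∈ nullSpace (T.induce {l, p}ᶜ) := by
  classical
  have := Fintype.ofFinite W
  have hlp : l ≠ p := ((hl p).2 rfl).ne
  rw [mem_nullSpace_iff] at hx
  have hp : x p = 0 := by simpa [hl] using hx l
  refine ⟨hp, ?_⟩
  rw [mem_nullSpace_iff]
  rintro ⟨u, hu⟩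
  have h := hx u
  rw [sum_eq_add_add_sum_compl_pair hlp] at h
  have hul : ¬ T.Adj u l := fun h' => hu (Or.inr ((hl u).1 h'.symm))
  simpa [hp, hul] using h

-- Extend by `0` at `p`, as the equation at `l` forces; the equation at `p` then determines the
-- value at `l`.
open Classical in
theorem exists_mem_nullSpace_of_mem_nullSpace_induce [Fintype W]
    (hl : ∀ w, T.Adj l w ↔ w = p) {y : ({l, p}ᶜ : Set W) → ℝ}
    (hy : y ∈ nullSpace (T.induce {l, p}ᶜ)) :
    ∃ x ∈ nullSpace T, (∀ w : ({l, p}ᶜ : Set W), x w = y w) ∧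
      x l = - ∑ w : ({l, p}ᶜ : Set W), if T.Adj p w then y w else 0 := by
  have hlp : l ≠ p := ((hl p).2 rfl).ne
  have hlm : l ∉ ({l, p}ᶜ : Set W) := by simp
  have hpm : p ∉ ({l, p}ᶜ : Set W) := by simp
  set s : ℝ := ∑ w : ({l, p}ᶜ : Set W), if T.Adj p w then y w else 0 with hs
  let x : W → ℝ := fun w => if h : w ∈ ({l, p}ᶜ : Set W) then y ⟨w, h⟩ else
    if w = l then -s else 0
  have hxl : x l = -s := by simp only [x, dif_neg hlm, if_true]
  have hxp : x p = 0 := by simp only [x, dif_neg hpm, if_neg hlp.symm]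
  have hxy : ∀ w : ({l, p}ᶜ : Set W), x w = y w := fun w => by simp only [x, dif_pos w.2]
  refine ⟨x, ?_, hxy, hxl⟩
  rw [mem_nullSpace_iff] at hy ⊢
  intro u
  rw [sum_eq_add_add_sum_compl_pair hlp]
  simp only [hxy, hxl, hxp, ite_self, add_zero]
  by_cases hul : u = l
  · subst hul
    have : ∀ w : ({u, p}ᶜ : Set W), (w : W) ≠ p := fun w h => w.2 (Or.inr h)
    simp [hl, this]
  by_cases hup : u = p
  · subst hup
    have : T.Adj u l := ((hl u).2 rfl).symm
    simp [this, ← hs]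
  · have hul' : ¬ T.Adj u l := fun h' => hup ((hl u).1 h'.symm)
    have := hy ⟨u, by simp [hul, hup]⟩
    simpa [hul'] using this

theorem notMem_supp_of_leaf [Finite W] (hl : ∀ w, T.Adj l w ↔ w = p) : p ∉ supp T := by
  rintro ⟨x, hx, hxp⟩
  exact hxp (eq_zero_and_comp_val_mem_nullSpace hl hx).1

theorem mem_supp_induce_iff [Finite W] (hl : ∀ w, T.Adj l w ↔ w = p)
    (w : ({l, p}ᶜ : Set W)) : w ∈ supp (T.induce {l, p}ᶜ) ↔ (w : W) ∈ supp T := by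
  classical
  have := Fintype.ofFinite W
  constructor
  · rintro ⟨y, hy, hyw⟩
    obtain ⟨x, hx, hxy, -⟩ := exists_mem_nullSpace_of_mem_nullSpace_induce hl hy
    exact ⟨x, hx, by rwa [hxy]⟩
  · rintro ⟨x, hx, hxw⟩
    exact ⟨_, (eq_zero_and_comp_val_mem_nullSpace hl hx).2, hxw⟩

theorem leaf_mem_supp_iff [Finite W] (hT : T.IsAcyclic) (hl : ∀ w, T.Adj l w ↔ w = p) :
    l ∈ supp T ↔ ∃ w : ({l, p}ᶜ : Set W), (w : W) ∈ supp T ∧ T.Adj p w := by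
  classical
  have := Fintype.ofFinite W
  have hlp : l ≠ p := ((hl p).2 rfl).ne
  constructor
  · rintro ⟨x, hx, hxl⟩
    by_contra! hcon
    have h := (mem_nullSpace_iff T x).1 hx p
    rw [sum_eq_add_add_sum_compl_pair hlp, Finset.sum_eq_zero] at h
    · have : T.Adj p l := ((hl p).2 rfl).symm
      simp [this] at h
      exact hxl h
    · intro w _
      split_ifs with hw
      · by_contra h0
        exact hcon w ⟨x, hx, h0⟩ hw
      · rfl
  · rintro ⟨w, hw, hpw⟩
    rw [← mem_supp_induce_iff hl] at hw
    -- Cutting `y` off to the component of `w` prevents cancellation: by acyclicity, `w` is the only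
    -- neighbour of `p` in that component.
    obtain ⟨y, hy, hyw, hy0⟩ := exists_mem_nullSpace_eq_zero_of_not_reachable hw
    obtain ⟨x, hx, -, hxl⟩ := exists_mem_nullSpace_of_mem_nullSpace_induce hl hy
    refine ⟨x, hx, ?_⟩
    rw [hxl, Finset.sum_eq_single w]
    · simpa [hpw] using hyw
    · intro c _ hc
      split_ifs with hpc
      · exact hy0 c (not_reachable_of_adj_of_adj hT (by simp) hpc hpw hc)
      · rfl
    · simp

theorem leaf_mem_nForest_iff [Finite W] (hl : ∀ w, T.Adj l w ↔ w = p) :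
    l ∈ (nForest T).verts ↔ l ∉ supp T := by
  rw [mem_nForest_verts_iff]
  refine ⟨And.left, fun h => ⟨h, fun s hs hsl => ?_⟩⟩
  rw [(hl s).1 hsl.symm] at hs
  exact notMem_supp_of_leaf hl hs

theorem leaf_neighbor_mem_nForest_iff [Finite W] (hT : T.IsAcyclic)
    (hl : ∀ w, T.Adj l w ↔ w = p) : p ∈ (nForest T).verts ↔ l ∉ supp T := by
  rw [mem_nForest_verts_iff]
  refine ⟨fun h h' => h.2 l h' ((hl p).2 rfl), fun h => ⟨notMem_supp_of_leaf hl, ?_⟩⟩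
  intro s hs hsp
  refine h ((leaf_mem_supp_iff hT hl).2 ⟨⟨s, ?_⟩, hs, hsp.symm⟩)
  rintro (rfl | rfl)
  · exact h hs
  · exact hsp.ne rfl

/-- Of the deleted vertices only `l` can be in the support, and its sole neighbour `p` is deleted
too. -/
theorem mem_nForest_induce_iff [Finite W] (hl : ∀ w, T.Adj l w ↔ w = p)
    (w : ({l, p}ᶜ : Set W)) :
    w ∈ (nForest (T.induce {l, p}ᶜ)).verts ↔ (w : W) ∈ (nForest T).verts := by
  rw [mem_nForest_verts_iff, mem_nForest_verts_iff, mem_supp_induce_iff hl]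
  refine and_congr_right fun _ => ⟨fun h s hs hsw => ?_, fun h s hs hsw => ?_⟩
  · have hsm : s ∈ ({l, p}ᶜ : Set W) := by
      rintro (rfl | rfl)
      · exact w.2 (Or.inr ((hl w).1 hsw))
      · exact notMem_supp_of_leaf hl hs
    exact h ⟨s, hsm⟩ ((mem_supp_induce_iff hl ⟨s, hsm⟩).2 hs) hsw
  · exact h s ((mem_supp_induce_iff hl s).1 hs) hsw

theorem ncard_eq_add_ncard_of_compl_pair [Finite W] {A : Set W} {B : Set ({l, p}ᶜ : Set W)}
    (h : ∀ w, w ∈ B ↔ (w : W) ∈ A) : A.ncard = (A ∩ {l, p}).ncard + B.ncard := by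
  have hB : Subtype.val '' B = A \ {l, p} := by
    ext w
    constructor
    · rintro ⟨w, hw, rfl⟩
      exact ⟨(h w).1 hw, w.2⟩
    · rintro ⟨hw, hw'⟩
      exact ⟨⟨w, hw'⟩, (h _).2 hw, rfl⟩
  rw [← Set.ncard_inter_add_ncard_sdiff_eq_ncard A {l, p}, ← hB,
    Set.ncard_image_of_injective _ Subtype.val_injective]

/-- The pair contributes two either way: `l` is in the support and neither vertex is in the
N-forest, or both are in the N-forest and neither is in the support. -/
theorem two_mul_ncard_supp_add_ncard_nForest [Finite W] (hT : T.IsAcyclic)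
    (hl : ∀ w, T.Adj l w ↔ w = p) :
    2 * (supp T).ncard + (nForest T).verts.ncard =
      2 * (supp (T.induce {l, p}ᶜ)).ncard + (nForest (T.induce {l, p}ᶜ)).verts.ncard + 2 := by
  have hlp : l ≠ p := ((hl p).2 rfl).ne
  rw [ncard_eq_add_ncard_of_compl_pair (mem_supp_induce_iff hl),
    ncard_eq_add_ncard_of_compl_pair (mem_nForest_induce_iff hl)]
  have hp := notMem_supp_of_leaf hl
  by_cases h : l ∈ supp T
  · have h1 : supp T ∩ {l, p} = {l} := by ext w; simp; grind
    have h2 : (nForest T).verts ∩ {l, p} = ∅ := by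
      have := (leaf_mem_nForest_iff hl).not_left.2 h
      have := (leaf_neighbor_mem_nForest_iff hT hl).not_left.2 h
      ext w; simp; grind
    rw [h1, h2, Set.ncard_singleton, Set.ncard_empty]
    ring
  · have h1 : supp T ∩ {l, p} = ∅ := by ext w; simp; grind
    have h2 : (nForest T).verts ∩ {l, p} = {l, p} := by
      have := (leaf_mem_nForest_iff hl).2 h
      have := (leaf_neighbor_mem_nForest_iff hT hl).2 h
      ext w; simp; grind
    rw [h1, h2, Set.ncard_pair hlp, Set.ncard_empty]
    ring

end Leaf

/-! ### Independence number of a forest -/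

section Independent

variable {W : Type*} {T : SimpleGraph W} {l p : W}

theorem isIndepSet_map_val {S : Set W} {I : Finset S} (hI : (T.induce S).IsIndepSet I) :
    T.IsIndepSet (I.map (Function.Embedding.subtype _) : Finset W) := by
  intro a ha b hb hab
  simp only [Finset.coe_map, Function.Embedding.subtype_apply, Set.mem_image] at ha hb
  obtain ⟨a, ha, rfl⟩ := ha
  obtain ⟨b, hb, rfl⟩ := hb
  exact hI ha hb fun h => hab (congrArg _ h)

theorem card_filter_mem_le_indepNum_induce [Finite W] (S : Set W) [DecidablePred (· ∈ S)]
    {I : Finset W} (hI : T.IsIndepSet I) : (I.filter (· ∈ S)).card ≤ (T.induce S).indepNum := by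
  have h : (T.induce S).IsIndepSet (I.subtype (· ∈ S) : Finset S) := by
    intro a ha b hb hab
    simp only [Finset.mem_coe, Finset.mem_subtype] at ha hb
    exact hI ha hb fun h => hab (Subtype.ext h)
  rw [← Finset.card_subtype]
  exact h.card_le_indepNum

theorem isIndepSet_cons_leaf (hl : ∀ w, T.Adj l w ↔ w = p) {I : Finset ({l, p}ᶜ : Set W)}
    (hI : (T.induce {l, p}ᶜ).IsIndepSet I)
    (h : l ∉ I.map (Function.Embedding.subtype _)) :
    T.IsIndepSet (Finset.cons l (I.map (Function.Embedding.subtype _)) h : Finset W) := by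
  rw [Finset.coe_cons]
  have : Std.Symm fun v w => ¬ T.Adj v w := ⟨fun _ _ h h' => h h'.symm⟩
  refine Set.Pairwise.insert_of_symm (isIndepSet_map_val hI) fun b hb _ hadj => ?_
  rw [(hl b).1 hadj] at hb
  simp at hb

theorem indepNum_eq_indepNum_induce_add_one [Finite W] (hl : ∀ w, T.Adj l w ↔ w = p) :
    T.indepNum = (T.induce {l, p}ᶜ).indepNum + 1 := by
  classical
  apply le_antisymm
  · obtain ⟨I, hI, hcard⟩ := T.exists_isNIndepSet_indepNum
    rw [← hcard, ← Finset.card_filter_add_card_filter_not (s := I) (· ∈ ({l, p}ᶜ : Set W))]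
    refine Nat.add_le_add ?_ (Finset.card_le_one.2 ?_)
    · convert card_filter_mem_le_indepNum_induce ({l, p}ᶜ : Set W) hI
    have hlp := (hl p).2 rfl
    intro a ha b hb
    simp only [Finset.mem_filter, Set.mem_compl_iff, not_not, Set.mem_insert_iff,
      Set.mem_singleton_iff] at ha hb
    by_contra hab
    have := hI ha.1 hb.1 hab
    rcases ha.2 with rfl | rfl <;> rcases hb.2 with rfl | rfl
    · exact hab rfl
    · exact this hlp
    · exact this hlp.symm
    · exact hab rfl
  · obtain ⟨I, hI, hcard⟩ := (T.induce ({l, p}ᶜ : Set W)).exists_isNIndepSet_indepNum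
    have := (isIndepSet_cons_leaf hl hI (by simp)).card_le_indepNum
    simpa [hcard] using this

/-- The independence number of a finite acyclic graph in terms of its support and `N`-forest;
every vertex outside the support is avoided by some maximum independent set. -/
theorem indepNum_of_isAcyclic (n : ℕ) : ∀ {W : Type*} [Finite W] (T : SimpleGraph W),
    Nat.card W = n → T.IsAcyclic →
      2 * T.indepNum = 2 * (supp T).ncard + (nForest T).verts.ncard ∧
      ∀ v ∉ supp T, ∃ I : Finset W, T.IsIndepSet I ∧ I.card = T.indepNum ∧ v ∉ I := by
  induction n using Nat.strong_induction_on with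
  | _ n ih =>
  intro W _ T hn hT
  classical
  have := Fintype.ofFinite W
  by_cases hedge : ∃ a b, T.Adj a b
  · obtain ⟨a, b, hab⟩ := hedge
    have hlt : ∀ l p : W, Nat.card ({l, p}ᶜ : Set W) < n := fun l p => by
      rw [← hn, Nat.card_coe_set_eq]
      exact Set.ncard_lt_card (fun h => (h ▸ Set.mem_univ l : l ∈ ({l, p}ᶜ : Set W)) (by simp))
    constructor
    · obtain ⟨l, p, -, hl⟩ := exists_leaf_ne hT hab a
      rw [two_mul_ncard_supp_add_ncard_nForest hT hl, indepNum_eq_indepNum_induce_add_one hl,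
        ← (ih _ (hlt l p) _ rfl (hT.induce _)).1]
      ring
    · intro v hv
      -- The leaf must differ from `v`, since it is added to the independent set; if `v = p`, it is
      -- avoided automatically.
      obtain ⟨l, p, hlv, hl⟩ := exists_leaf_ne hT hab v
      obtain ⟨I, hI, hcard, hvI⟩ : ∃ I : Finset ({l, p}ᶜ : Set W),
          (T.induce {l, p}ᶜ).IsIndepSet I ∧ I.card = (T.induce {l, p}ᶜ).indepNum ∧
          v ∉ I.map (Function.Embedding.subtype _) := by
        by_cases hvp : v = p
        · obtain ⟨I, hI, hcard⟩ := (T.induce ({l, p}ᶜ : Set W)).exists_isNIndepSet_indepNum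
          exact ⟨I, hI, hcard, by simp [hvp]⟩
        · have hvm : v ∈ ({l, p}ᶜ : Set W) := by simp [hlv.symm, hvp]
          obtain ⟨I, hI, hcard, hvI⟩ := (ih _ (hlt l p) _ rfl (hT.induce _)).2 ⟨v, hvm⟩
            fun h => hv ((mem_supp_induce_iff hl ⟨v, hvm⟩).1 h)
          exact ⟨I, hI, hcard, by simpa using fun _ _ => hvI⟩
      refine ⟨_, isIndepSet_cons_leaf hl hI (by simp), ?_, ?_⟩
      · rw [Finset.card_cons, Finset.card_map, hcard, indepNum_eq_indepNum_induce_add_one hl]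
      · rw [Finset.mem_cons, not_or]
        exact ⟨hlv.symm, hvI⟩
  · push Not at hedge
    -- Without edges every vector is a null vector, so the avoidance claim is vacuous.
    have hsupp : supp T = Set.univ := by
      refine Set.eq_univ_of_forall fun w => ⟨fun _ => 1, ?_, one_ne_zero⟩
      rw [mem_nullSpace_iff]
      simp [hedge]
    have hN : (nForest T).verts = ∅ := by
      ext w
      simp [mem_nForest_verts_iff, hsupp]
    have hle : T.indepNum = Nat.card W := by
      apply le_antisymm
      · obtain ⟨I, hI, hcard⟩ := T.exists_isNIndepSet_indepNum
        rw [← hcard, Nat.card_eq_fintype_card]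
        exact I.card_le_univ
      · have : T.IsIndepSet (Finset.univ : Finset W) := fun a _ b _ _ => hedge a b
        simpa using this.card_le_indepNum
    simp [hsupp, hN, hle, Set.ncard_univ]

end Independent

/-! ### Gluing along the root of a pendant tree -/

section Pendant

variable {V : Type*} {G : SimpleGraph V} {C : G.Subgraph} {v : V}

/-- In a unicyclic graph every induced subgraph that misses a vertex of the cycle is acyclic. -/
theorem isAcyclic_induce_of_notMem (hG : IsUnicyclic G) (hC : IsCycleSubgraph C) {S : Set V}
    {u : V} (huC : u ∈ C.verts) (hu : u ∉ S) : (G.induce S).IsAcyclic := by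
  intro a q hq
  have hq' : (q.map (Embedding.induce S).toHom).IsCycle :=
    (Walk.isCycle_map_iff_of_injective Subtype.val_injective).2 hq
  have hCq : (q.map (Embedding.induce S).toHom).toSubgraph = C :=
    hG.2.unique ⟨_, _, hq', rfl⟩ hC
  rw [← hCq, Walk.mem_verts_toSubgraph, Walk.support_map, List.mem_map] at huC
  obtain ⟨c, -, hc⟩ := huC
  exact hu (hc ▸ c.2)

theorem exists_mem_verts_ne (hC : IsCycleSubgraph C) (v : V) : ∃ u ∈ C.verts, u ≠ v := by
  obtain ⟨a, q, hq, rfl⟩ := hC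
  have hadj := q.adj_snd hq.not_nil
  by_cases h : a = v
  · exact ⟨q.snd, by simp, fun h' => hadj.ne (h.trans h'.symm)⟩
  · exact ⟨a, by simp, h⟩

/-- An edge with an end outside the cycle of a unicyclic graph is a bridge. -/
theorem isBridge_of_notMem_verts (hG : IsUnicyclic G) (hC : IsCycleSubgraph C) {a b : V}
    (hab : G.Adj a b) (ha : a ∉ C.verts) : G.IsBridge s(a, b) := by
  rw [isBridge_iff_forall_cycle_notMem hab]
  intro u q hq hmem
  apply ha
  rw [← hG.2.unique ⟨u, q, hq, rfl⟩ hC, Walk.mem_verts_toSubgraph]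
  exact Walk.fst_mem_support_of_mem_edges _ hmem

/-- The root is the only vertex of a pendant tree with neighbours outside it. -/
theorem eq_of_adj_of_notMem_pendantVerts (hG : IsUnicyclic G) (hC : IsCycleSubgraph C)
    (hvC : v ∈ C.verts) {a b : V} (ha : a ∈ pendantVerts G C v) (hb : b ∉ pendantVerts G C v)
    (hab : G.Adj a b) : a = v := by
  obtain ⟨hvP, hP, hconn⟩ := (isGreatest_pendantVerts G C v).1
  by_contra hav
  have haC : a ∉ C.verts := fun h => hav (hP a ha h)
  by_cases hbC : b ∈ C.verts
  -- Going from `a` to `v` in the tree and on to `b` within the cycle's vertices avoids the edge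
  -- `ab`, which is a bridge.
  · have hCconn : (G.induce C.verts).Connected := by
      obtain ⟨u, q, -, rfl⟩ := hC
      exact q.toSubgraph_connected.induce_verts
    obtain ⟨q₁, h₁⟩ := exists_walk_support_subset (hconn.preconnected ⟨a, ha⟩ ⟨v, hvP⟩)
    obtain ⟨q₂, h₂⟩ := exists_walk_support_subset (hCconn.preconnected ⟨v, hvC⟩ ⟨b, hbC⟩)
    have hmem := isBridge_iff_forall_walk_mem_edges.1 (isBridge_of_notMem_verts hG hC hab haC)
      (q₁.append q₂)
    rw [Walk.edges_append, List.mem_append] at hmem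
    rcases hmem with h | h
    · exact hb (h₁ b (Walk.snd_mem_support_of_mem_edges _ h))
    · exact haC (h₂ a (Walk.fst_mem_support_of_mem_edges _ h))
  -- Off the cycle, `b` could be added to the pendant tree, against its maximality.
  · have hmem : pendantVerts G C v ∪ {a, b} ∈ pendantFamily G C v := by
      refine ⟨Or.inl hvP, ?_, ?_⟩
      · rintro w (hw | rfl | rfl) hwC
        · exact hP w hw hwC
        · exact absurd hwC haC
        · exact absurd hwC hbC
      · exact induce_union_connected hconn.preconnected
          (induce_pair_connected_of_adj hab).preconnected ⟨a, ha, Or.inl rfl⟩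
    exact hb ((isGreatest_pendantVerts G C v).2 hmem (Or.inr (Or.inr rfl)))

/-- If the root of a pendant tree is avoided by some maximum independent set of the tree, then
the independence numbers of the tree and of its complement add up. -/
theorem indepNum_eq_add [Finite V] (hG : IsUnicyclic G) (hC : IsCycleSubgraph C)
    (hvC : v ∈ C.verts) {I : Finset (pendantVerts G C v)}
    (hI : (pendantTree G C v).IsIndepSet I) (hcard : I.card = (pendantTree G C v).indepNum)
    (hv : pendantRoot G C v ∉ I) :
    G.indepNum = (pendantTree G C v).indepNum + (pendantCompl G C v).indepNum := by
  classical
  apply le_antisymm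
  · obtain ⟨K, hK, hKcard⟩ := G.exists_isNIndepSet_indepNum
    rw [← hKcard, ← Finset.card_filter_add_card_filter_not (s := K) (· ∈ pendantVerts G C v)]
    refine Nat.add_le_add (card_filter_mem_le_indepNum_induce _ hK) ?_
    convert card_filter_mem_le_indepNum_induce (pendantVerts G C v)ᶜ hK
  · obtain ⟨J, hJ, hJcard⟩ := (pendantCompl G C v).exists_isNIndepSet_indepNum
    have hdisj : Disjoint (I.map (Function.Embedding.subtype _))
        (J.map (Function.Embedding.subtype _)) := by
      rw [Finset.disjoint_left]
      intro x hx hx'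
      simp only [Finset.mem_map, Function.Embedding.subtype_apply] at hx hx'
      obtain ⟨x, -, rfl⟩ := hx
      obtain ⟨y, -, hy⟩ := hx'
      exact y.2 (hy ▸ x.2)
    have hind : G.IsIndepSet
        ((I.map (Function.Embedding.subtype _)).disjUnion
          (J.map (Function.Embedding.subtype _)) hdisj : Finset V) := by
      rw [Finset.coe_disjUnion]
      have : Std.Symm fun v w => ¬ G.Adj v w := ⟨fun _ _ h h' => h h'.symm⟩
      refine Set.pairwise_union_of_symm.2
        ⟨isIndepSet_map_val hI, isIndepSet_map_val hJ, ?_⟩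
      intro a ha b hb _ hab
      simp only [Finset.coe_map, Function.Embedding.subtype_apply, Set.mem_image] at ha hb
      obtain ⟨a, ha, rfl⟩ := ha
      obtain ⟨b, -, rfl⟩ := hb
      have := eq_of_adj_of_notMem_pendantVerts hG hC hvC a.2 b.2 hab
      exact hv ((Subtype.ext this : a = pendantRoot G C v) ▸ ha)
    have := hind.card_le_indepNum
    rwa [Finset.card_disjUnion, Finset.card_map, Finset.card_map, hcard, hJcard] at this

end Pendant

end NullDecomp

theorem mainTheorem2 {V : Type*} [Finite V] (G : SimpleGraph V)
    (hG : NullDecomp.IsTypeI G)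
    (C : G.Subgraph) (hC : NullDecomp.IsCycleSubgraph C)
    (v : V) (hvC : v ∈ C.verts)
    (hv : NullDecomp.pendantRoot G C v ∉ NullDecomp.supp (NullDecomp.pendantTree G C v)) :
    (G.indepNum : ℚ) =
      (NullDecomp.supp (NullDecomp.pendantTree G C v)).ncard
        + (NullDecomp.supp (NullDecomp.pendantCompl G C v)).ncard
        + (((NullDecomp.nForest (NullDecomp.pendantTree G C v)).verts.ncard : ℚ)
          + (NullDecomp.nForest (NullDecomp.pendantCompl G C v)).verts.ncard) / 2 := by
  -- Each piece misses a cycle vertex, the tree `u` and its complement `v`, and so is acyclic.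
  obtain ⟨u, huC, huv⟩ := NullDecomp.exists_mem_verts_ne hC v
  have hu : u ∉ NullDecomp.pendantVerts G C v := fun h =>
    huv ((NullDecomp.isGreatest_pendantVerts G C v).1.2.1 u h huC)
  have htree : (NullDecomp.pendantTree G C v).IsAcyclic :=
    NullDecomp.isAcyclic_induce_of_notMem hG.1 hC huC hu
  have hcompl : (NullDecomp.pendantCompl G C v).IsAcyclic :=
    NullDecomp.isAcyclic_induce_of_notMem hG.1 hC hvC
      fun h => h (NullDecomp.mem_pendantVerts_self G C v)
  obtain ⟨h₁, havoid⟩ := NullDecomp.indepNum_of_isAcyclic _ _ rfl htree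
  obtain ⟨h₂, -⟩ := NullDecomp.indepNum_of_isAcyclic _ _ rfl hcompl
  obtain ⟨I, hI, hcard, hvI⟩ := havoid _ hv
  have h := NullDecomp.indepNum_eq_add hG.1 hC hvC hI hcard hvI
  qify at h h₁ h₂
  linarith
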